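/- Let $(X,\mathfrak B,\mu)$ be a standard Borel space with a $\sigma$-finite, nonatomic measure $\mu$ such that $\mu(X)=\infty$. For an invertible bimeasurable nonsingular transformation $S$ of a $\sigma$-finite measure space $(Y,\nu)$ put $S':=\frac{d(\nu\circ S^{-1})}{d\nu}$; here nonsingular means that $\nu\circ S^{-1}$ and $\nu$ have the same null sets. Let $\mathrm{Aut}_1(X,\mu)$ (respectively $\mathrm{Aut}_2(X,\mu)$) be the set of all such $S$ on $(X,\mu)$ with $S'-1\in L^1(X,\mu)$ (respectively $\sqrt{S'}-1\in L^2(X,\mu)$). Let $X^*$ be the space of counting measures $\omega=\sum_i\delta_{x_i}$ (countable sums of Dirac masses) on $X$, with the $\sigma$-algebra generated by the maps $\omega\mapsto\omega(A)$, $A\in\mathfrak B$. For a $\sigma$-finite measure $\lambda$ on $X$ let $\lambda^*$ be the law on $X^*$ of the Poisson point process with intensity $\lambda$. For $T\in \mathrm{Aut}_2(X,\mu)$, the Poisson suspension $T_*$ is the transformation $T_*\omega=\omega\circ T^{-1}$ of $X^*$. A nonsingular invertible transformation $S$ of $(Y,\nu)$ is conservative if for each measurable $B$ with $\nu(B)>0$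 there is $n>0$ with $\nu(S^{-n}B\cap B)>0$, and totally dissipative if there is a measurable $B$ whose images $S^nB$, $n\in\mathbb Z$, are pairwise disjoint and cover $Y$ up to a $\nu$-null set. For $T\in\mathrm{Aut}_2(X,\mu)$ we say that $T_*$ is conservatively concrete for intensity scaling (CCIS) if for each $t>0$ the transformation $T_*$ of $(X^*,(t\mu)^*)$ is either conservative or totally dissipative. **Theorem 7.2.** Let $T\in\mathrm{Aut}_1(X,\mu)$. Suppose that there is $\alpha>1$ such that, for each $n>0$, $\alpha^{-1}<(T^n)'(x)<\alpha$ at $\mu$-a.e. $x\in X$. Then $T_*$, as a nonsingular transformation of $(X^*,\mu^*)$, is either conservative or totally dissipative. Hence $T_*$ is CCIS. -/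

import Mathlib

open MeasureTheory Set Filter
open scoped ENNReal NNReal

noncomputable section

namespace PoissonSuspension

/-! ### Nonsingular invertible transformations -/

/-- `S` is an invertible nonsingular transformation of `(Y, ν)`: it is a bimeasurable bijection and
the image of `ν` under `S` has the same null sets as `ν`. -/
structure IsNonsingular {Y : Type*} [MeasurableSpace Y] (S : Y ≃ᵐ Y) (ν : Measure Y) : Prop where
  absolutelyContinuous_map : ν.map S ≪ ν
  absolutelyContinuous_of_map : ν ≪ ν.map S

/-- The Radon-Nikodym derivative `S' = d(ν ∘ S⁻¹) / dν` (for nonsingular `S` and `σ`-finite `ν`, it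
is finite almost everywhere). -/
def jac {Y : Type*} [MeasurableSpace Y] (S : Y → Y) (ν : Measure Y) (y : Y) : ℝ :=
  ((ν.map S).rnDeriv ν y).toReal

/-- `S` belongs to `Aut₁(Y, ν)`: it is nonsingular and `S' - 1 ∈ L¹(ν)`. -/
structure MemAutOne {Y : Type*} [MeasurableSpace Y] (S : Y ≃ᵐ Y) (ν : Measure Y) : Prop where
  nonsingular : IsNonsingular S ν
  integrable : Integrable (fun y => jac S ν y - 1) ν

/-- `S` belongs to `Aut₂(Y, ν)`: it is nonsingular and `√S' - 1 ∈ L²(ν)`. -/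
structure MemAutTwo {Y : Type*} [MeasurableSpace Y] (S : Y ≃ᵐ Y) (ν : Measure Y) : Prop where
  nonsingular : IsNonsingular S ν
  memLp : MemLp (fun y => Real.sqrt (jac S ν y) - 1) 2 ν

/-- `S` is a totally dissipative nonsingular transformation of `(Y, ν)`: there is a measurable set
`B` whose images `Sⁿ B`, `n ∈ ℤ`, are pairwise disjoint and cover `Y` up to a null set. -/
structure IsTotallyDissipative {Y : Type*} [MeasurableSpace Y] (S : Y ≃ᵐ Y) (ν : Measure Y) :
    Prop where
  nonsingular : IsNonsingular S ν
  wandering : ∃ B : Set Y, MeasurableSet B ∧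
    Pairwise (fun m n : ℤ => Disjoint (((S.toEquiv : Equiv.Perm Y) ^ m) '' B)
      (((S.toEquiv : Equiv.Perm Y) ^ n) '' B)) ∧
    ν (⋃ n : ℤ, ((S.toEquiv : Equiv.Perm Y) ^ n) '' B)ᶜ = 0

/-! ### The configuration space -/

/-- `ω` is a countable sum of Dirac masses. -/
def IsCounting {X : Type*} [MeasurableSpace X] (ω : Measure X) : Prop :=
  ∃ (ι : Type) (_ : Countable ι) (x : ι → X), ω = Measure.sum fun i => Measure.dirac (x i)

/-- The space `X*` of counting measures `ω = ∑ᵢ δ_{xᵢ}` on `X`. It carries the `σ`-algebra that is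
generated by the evaluations `ω ↦ ω A`, for `A ⊆ X` measurable (this is the `σ`-algebra induced
from Mathlib's `σ`-algebra on `Measure X`). -/
abbrev Config (X : Type*) [MeasurableSpace X] : Type _ := {ω : Measure X // IsCounting ω}

/-- The configuration `δ_{x₁} + ⋯ + δ_{xₙ}`. -/
def pointConfig {X : Type*} [MeasurableSpace X] (n : ℕ) (x : Fin n → X) : Config X :=
  ⟨Measure.sum fun i => Measure.dirac (x i), Fin n, inferInstance, x, rfl⟩

/-- The superposition `∑ᵢ ωᵢ` of a sequence of configurations. -/
def superpose {X : Type*} [MeasurableSpace X] (ω : ℕ → Config X) : Config X :=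
  ⟨Measure.sum fun i => (ω i).1, by
    choose ι hι x hx using fun i => (ω i).2
    refine ⟨Σ i, ι i, inferInstance, fun p => x p.1 p.2, ?_⟩
    ext s hs
    simp only [Measure.sum_apply _ hs]
    rw [ENNReal.tsum_sigma']
    refine tsum_congr fun i => ?_
    rw [hx i, Measure.sum_apply _ hs]⟩

theorem IsCounting.map {X : Type*} [MeasurableSpace X] {ω : Measure X} (h : IsCounting ω)
    {f : X → X} (hf : Measurable f) : IsCounting (ω.map f) := by
  obtain ⟨ι, hι, x, rfl⟩ := h
  refine ⟨ι, hι, fun i => f (x i), ?_⟩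
  rw [Measure.map_sum hf.aemeasurable]
  simp only [Measure.map_dirac' hf]

theorem measurable_pointConfig {X : Type*} [MeasurableSpace X] (n : ℕ) :
    Measurable (pointConfig (X := X) n) := by
  refine Measurable.subtype_mk (Measure.measurable_of_measurable_coe _ fun s hs => ?_)
  simp only [Measure.sum_apply _ hs]
  refine Measurable.tsum fun i => ?_
  exact (Measure.measurable_coe hs).comp (Measure.measurable_dirac.comp (measurable_pi_apply i))

theorem measurable_superpose {X : Type*} [MeasurableSpace X] :
    Measurable (superpose (X := X)) := by
  refine Measurable.subtype_mk (Measure.measurable_of_measurable_coe _ fun s hs => ?_)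
  simp only [Measure.sum_apply _ hs]
  refine Measurable.tsum fun i => ?_
  exact (Measure.measurable_coe hs).comp (measurable_subtype_coe.comp (measurable_pi_apply i))

/-- The Poisson suspension `T_*` of `T` as a transformation of the configuration space:
`T_* ω = ω ∘ T⁻¹`, that is `T_* (∑ᵢ δ_{xᵢ}) = ∑ᵢ δ_{T xᵢ}`. -/
def suspension {X : Type*} [MeasurableSpace X] (T : X ≃ᵐ X) : Config X ≃ᵐ Config X where
  toFun ω := ⟨ω.1.map T, ω.2.map T.measurable⟩
  invFun ω := ⟨ω.1.map T.symm, ω.2.map T.symm.measurable⟩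
  left_inv ω := Subtype.ext (by simp)
  right_inv ω := Subtype.ext (by simp)
  measurable_toFun := Measurable.subtype_mk
    ((Measure.measurable_map _ T.measurable).comp measurable_subtype_coe)
  measurable_invFun := Measurable.subtype_mk
    ((Measure.measurable_map _ T.symm.measurable).comp measurable_subtype_coe)

/-! ### The Poisson measure -/

/-- The law of the Poisson point process of finite intensity measure `ν`: it is
`e^{-ν(X)} ∑ₙ (1 / n!) (law of δ_{x₁} + ⋯ + δ_{xₙ} under ν^{⊗ n})`. Equivalently, the number of
points has the Poisson distribution of mean `ν(X)` and, given that it is `n`, the points are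
independent with distribution `ν / ν(X)`. -/
def finitePoisson {X : Type*} [MeasurableSpace X] (ν : Measure X) : Measure (Config X) :=
  ENNReal.ofReal (Real.exp (-(ν univ).toReal)) •
    Measure.sum fun n : ℕ =>
      ((n.factorial : ℝ≥0∞)⁻¹) • (Measure.pi fun _ : Fin n => ν).map (pointConfig n)

theorem isProbabilityMeasure_finitePoisson {X : Type*} [MeasurableSpace X] (ν : Measure X)
    [IsFiniteMeasure ν] : IsProbabilityMeasure (finitePoisson ν) := by
  have hpi : ∀ n : ℕ, ((Measure.pi fun _ : Fin n => ν).map (pointConfig n)) univ =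
      (ν univ) ^ n := fun n => by
    rw [Measure.map_apply (measurable_pointConfig n) MeasurableSet.univ, preimage_univ,
      Measure.pi_univ]
    simp
  have h1 := ProbabilityTheory.hasSum_one_poissonMeasure (ν univ).toNNReal
  refine ⟨?_⟩
  rw [finitePoisson, Measure.smul_apply, Measure.sum_apply _ MeasurableSet.univ, smul_eq_mul,
    ← ENNReal.tsum_mul_left]
  simp only [Measure.smul_apply, smul_eq_mul, hpi]
  rw [← ENNReal.ofReal_one, ← h1.tsum_eq,
    ENNReal.ofReal_tsum_of_nonneg (fun n => by positivity) h1.summable]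
  refine tsum_congr fun n => ?_
  rw [mul_div_assoc, ENNReal.ofReal_mul (Real.exp_pos _).le,
    ENNReal.ofReal_div_of_pos (by positivity), ENNReal.ofReal_pow NNReal.zero_le_coe,
    ENNReal.ofReal_coe_nnreal, ENNReal.coe_toNNReal (measure_ne_top ν univ),
    ENNReal.ofReal_natCast, ENNReal.div_eq_inv_mul]
  rfl

/-- The law `μ*` of the Poisson point process of `σ`-finite intensity measure `μ`: cut `X` into
countably many disjoint pieces of finite measure and superpose independent Poisson point processes
on the pieces. This is the unique probability measure on `Config X` for which the numbers of points
`ω A₁, …, ω Aₖ` in disjoint sets of finite measure are independent Poisson variables of means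
`μ A₁, …, μ Aₖ`; in particular it does not depend on the way in which `X` is cut. -/
def poissonLaw {X : Type*} [MeasurableSpace X] (μ : Measure X) [SigmaFinite μ] :
    Measure (Config X) :=
  (Measure.infinitePi fun i : ℕ =>
    finitePoisson (μ.restrict (disjointed (spanningSets μ) i))).map superpose

theorem isProbabilityMeasure_poissonLaw {X : Type*} [MeasurableSpace X] (μ : Measure X)
    [SigmaFinite μ] : IsProbabilityMeasure (poissonLaw μ) := by
  have hfin : ∀ i : ℕ, IsProbabilityMeasure
      (finitePoisson (μ.restrict (disjointed (spanningSets μ) i))) := fun i => by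
    have : IsFiniteMeasure (μ.restrict (disjointed (spanningSets μ) i)) :=
      ⟨by
        rw [Measure.restrict_apply_univ]
        exact (measure_mono (disjointed_subset _ _)).trans_lt (measure_spanningSets_lt_top μ i)⟩
    exact isProbabilityMeasure_finitePoisson _
  exact Measure.isProbabilityMeasure_map measurable_superpose.aemeasurable

/-- `T_*` is conservatively concrete for intensity scaling: `T ∈ Aut₂(X, μ)` and, for every `t > 0`,
the Poisson suspension `(X*, (t μ)*, T_*)` is either conservative or totally dissipative. -/
structure IsCCIS {X : Type*} [MeasurableSpace X] (T : X ≃ᵐ X) (μ : Measure X) [SigmaFinite μ] :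
    Prop where
  memAutTwo : MemAutTwo T μ
  dichotomy : ∀ t : ℝ≥0, 0 < t →
    Conservative (suspension T) (poissonLaw (t • μ)) ∨
      IsTotallyDissipative (suspension T) (poissonLaw (t • μ))

end PoissonSuspension

end

open PoissonSuspension

/-! The `n`-th iterate of `T_*` carries the Poisson law of intensity `μ` to that of intensity `φₙ
μ`, where `φₙ = (Tⁿ)'`. Since `φₙ - 1` is integrable and `log φₙ` is bounded by `log α`, this image
law has the density `hₙ(ω) = kₙ ∏_{x ∈ ω} φₙ(x)` (`HasLaplace.exists_density`). By Hopf's criterion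
(`conservative_or_totallyDissipative`), `T_*` is conservative if `∑ₙ hₙ = ∞` almost surely and
totally dissipative if `∑ₙ hₙ < ∞` almost surely, so only a mixture of the two must be excluded.

The uniform bound on the derivatives does this. Deleting `m` points from `ω` changes every `hₙ(ω)`
by a factor between `α⁻ᵐ` and `αᵐ`, whatever `n` is, so divergence of the sum is unaffected. The
process is a superposition of independent pieces with finitely many points each, so divergence is
almost surely a tail event, and Kolmogorov's zero-one law applies
(`ae_tsum_density_eq_top_or_ne_top`).

Replacing `μ` by `t μ` leaves the derivatives, their bounds and their integrability unchanged, which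
gives CCIS. -/

namespace PoissonSuspension

/-! ### The Laplace functional of the Poisson process -/

/-- The function `x ↦ e^{-x}` on `[0, ∞]`. -/
noncomputable def expNeg (x : ℝ≥0∞) : ℝ≥0∞ := EReal.exp (-(x : EReal))

theorem expNeg_zero : expNeg 0 = 1 := by simp [expNeg]

theorem expNeg_top : expNeg ∞ = 0 := by simp [expNeg]

theorem expNeg_ofReal {x : ℝ} (hx : 0 ≤ x) :
    expNeg (ENNReal.ofReal x) = ENNReal.ofReal (Real.exp (-x)) := by
  rw [expNeg, EReal.coe_ennreal_ofReal, max_eq_left hx, ← EReal.coe_neg, EReal.exp_coe]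

theorem expNeg_add (x y : ℝ≥0∞) : expNeg (x + y) = expNeg x * expNeg y := by
  rw [expNeg, expNeg, expNeg, ← EReal.exp_add, EReal.coe_ennreal_add, EReal.neg_add,
    sub_eq_add_neg]
  · left; simp
  · right; simp

theorem expNeg_antitone : Antitone expNeg := fun _ _ h =>
  EReal.exp_monotone (EReal.neg_le_neg_iff.2 (EReal.coe_ennreal_le_coe_ennreal_iff.2 h))

theorem expNeg_le_one (x : ℝ≥0∞) : expNeg x ≤ 1 := by
  rw [← expNeg_zero]; exact expNeg_antitone (by simp)

theorem expNeg_ne_top (x : ℝ≥0∞) : expNeg x ≠ ∞ :=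
  ((expNeg_le_one x).trans_lt ENNReal.one_lt_top).ne

theorem expNeg_eq_zero_iff {x : ℝ≥0∞} : expNeg x = 0 ↔ x = ∞ := by
  simp [expNeg]

theorem continuous_expNeg : Continuous expNeg :=
  ENNReal.continuous_exp.comp (continuous_neg.comp continuous_coe_ennreal_ereal)

theorem measurable_expNeg : Measurable expNeg := continuous_expNeg.measurable

theorem expNeg_sum {ι : Type*} (s : Finset ι) (x : ι → ℝ≥0∞) :
    expNeg (∑ i ∈ s, x i) = ∏ i ∈ s, expNeg (x i) := by
  classical
  induction s using Finset.induction_on with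
  | empty => simp [expNeg_zero]
  | insert a s ha ih => rw [Finset.sum_insert ha, Finset.prod_insert ha, expNeg_add, ih]

/-- The factors are at most `1`, so the partial products decrease. The infimum form lets the product
pass through integrals by monotone convergence. -/
theorem expNeg_tsum (x : ℕ → ℝ≥0∞) :
    expNeg (∑' i, x i) = ⨅ N, ∏ i ∈ Finset.range N, expNeg (x i) := by
  have h1 : Tendsto (fun N => ∏ i ∈ Finset.range N, expNeg (x i)) atTop
      (nhds (expNeg (∑' i, x i))) := by
    simp_rw [← expNeg_sum]
    exact (continuous_expNeg.tendsto _).comp ENNReal.summable.hasSum.tendsto_sum_nat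
  refine tendsto_nhds_unique h1 (tendsto_atTop_iInf fun m n hmn => ?_)
  exact Finset.prod_le_prod_of_subset_of_le_one' (by simpa using hmn)
    fun i _ _ => expNeg_le_one _

/-- The integral over a finite power of a measure of a product of functions of the coordinates. -/
theorem lintegral_pi_fin_prod {X : Type*} [MeasurableSpace X] (ν : Measure X) [SigmaFinite ν]
    {f : X → ℝ≥0∞} (hf : Measurable f) (n : ℕ) :
    ∫⁻ x, ∏ i, f (x i) ∂(Measure.pi fun _ : Fin n => ν) = (∫⁻ x, f x ∂ν) ^ n := by
  induction n with
  | zero => simp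
  | succ n ih =>
    have hmp := measurePreserving_piFinSuccAbove (fun _ : Fin (n + 1) => ν) 0
    have h2 := hmp.lintegral_comp (f := fun p : X × (Fin n → X) => f p.1 * ∏ i, f (p.2 i))
      (by fun_prop)
    rw [lintegral_prod_mul (g := fun y : Fin n → X => ∏ i, f (y i)) hf.aemeasurable
      (Finset.measurable_prod _ fun i _ => hf.comp (measurable_pi_apply i)).aemeasurable, ih] at h2
    rw [pow_succ', ← h2]
    refine lintegral_congr fun x => ?_
    rw [Fin.prod_univ_succ]
    rfl

theorem lintegral_pointConfig {X : Type*} [MeasurableSpace X] {f : X → ℝ≥0∞} (hf : Measurable f)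
    {n : ℕ} (x : Fin n → X) : ∫⁻ y, f y ∂(pointConfig n x).1 = ∑ i, f (x i) := by
  simp [pointConfig, lintegral_dirac' _ hf]

theorem lintegral_superpose {X : Type*} [MeasurableSpace X] (f : X → ℝ≥0∞)
    (ω : ℕ → Config X) : ∫⁻ y, f y ∂(superpose ω).1 = ∑' i, ∫⁻ y, f y ∂(ω i).1 := by
  simp [superpose, lintegral_sum_measure]

theorem measurable_config_lintegral {X : Type*} [MeasurableSpace X] {f : X → ℝ≥0∞}
    (hf : Measurable f) : Measurable fun ω : Config X => ∫⁻ y, f y ∂ω.1 :=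
  (Measure.measurable_lintegral hf).comp measurable_subtype_coe

/-- The law `P` on the configuration space has the Laplace functional of the Poisson point process
of intensity `μ`. -/
def HasLaplace {X : Type*} [MeasurableSpace X] (P : Measure (Config X)) (μ : Measure X) : Prop :=
  ∀ f : X → ℝ≥0∞, Measurable f →
    ∫⁻ ω, expNeg (∫⁻ y, f y ∂ω.1) ∂P = expNeg (∫⁻ x, (1 - expNeg (f x)) ∂μ)

/-- The `n`-point part contributes `cⁿ / n!` with `c = ∫ e^{-f} dν`. The exponential series sums to
`e^{c - ν(X)}`, and `ν(X) - c = ∫ (1 - e^{-f}) dν`. -/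
theorem hasLaplace_finitePoisson {X : Type*} [MeasurableSpace X] (ν : Measure X)
    [IsFiniteMeasure ν] : HasLaplace (finitePoisson ν) ν := by
  intro f hf
  have hm : Measurable fun ω : Config X => expNeg (∫⁻ y, f y ∂ω.1) :=
    measurable_expNeg.comp (measurable_config_lintegral hf)
  have hE : Measurable fun x => expNeg (f x) := measurable_expNeg.comp hf
  set c : ℝ≥0∞ := ∫⁻ x, expNeg (f x) ∂ν with hc
  have hcle : c ≤ ν univ := by
    rw [← lintegral_one]; exact lintegral_mono fun x => expNeg_le_one _
  have hct : c ≠ ∞ := (hcle.trans_lt (measure_lt_top ν univ)).ne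
  have hterm : ∀ n : ℕ, ∫⁻ ω, expNeg (∫⁻ y, f y ∂ω.1)
      ∂((Measure.pi fun _ : Fin n => ν).map (pointConfig n)) = c ^ n := fun n => by
    rw [lintegral_map hm (measurable_pointConfig n), ← lintegral_pi_fin_prod ν hE]
    refine lintegral_congr fun x => ?_
    rw [lintegral_pointConfig hf, expNeg_sum]
  rw [finitePoisson, lintegral_smul_measure, lintegral_sum_measure]
  simp only [lintegral_smul_measure, hterm, smul_eq_mul]
  rw [lintegral_sub hE hct (ae_of_all _ fun x => expNeg_le_one _), lintegral_one, ← hc]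
  obtain ⟨a, ha0, ha⟩ : ∃ a : ℝ, 0 ≤ a ∧ c = ENNReal.ofReal a :=
    ⟨c.toReal, ENNReal.toReal_nonneg, (ENNReal.ofReal_toReal hct).symm⟩
  have hsum : ∑' n : ℕ, ((n.factorial : ℝ≥0∞)⁻¹) * c ^ n = ENNReal.ofReal (Real.exp a) := by
    have h1 : HasSum (fun n : ℕ => a ^ n / n.factorial) (Real.exp a) := by
      rw [Real.exp_eq_exp_ℝ]; exact NormedSpace.expSeries_div_hasSum_exp a
    rw [← h1.tsum_eq, ENNReal.ofReal_tsum_of_nonneg (fun n => by positivity) h1.summable]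
    refine tsum_congr fun n => ?_
    rw [ENNReal.ofReal_div_of_pos (by positivity), ENNReal.ofReal_pow ha0, ← ha,
      ENNReal.ofReal_natCast, ENNReal.div_eq_inv_mul]
  rw [hsum, ← ENNReal.ofReal_mul (Real.exp_pos _).le, ← Real.exp_add]
  have hν : ν univ = ENNReal.ofReal (ν univ).toReal :=
    (ENNReal.ofReal_toReal (measure_ne_top ν univ)).symm
  have hle : a ≤ (ν univ).toReal := by
    rw [ha, hν] at hcle
    exact (ENNReal.ofReal_le_ofReal_iff ENNReal.toReal_nonneg).1 hcle
  rw [ha]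
  nth_rewrite 2 [hν]
  rw [← ENNReal.ofReal_sub _ ha0, expNeg_ofReal (by linarith)]
  congr 2; ring

instance isFiniteMeasure_restrict_disjointed_spanningSets {X : Type*} [MeasurableSpace X]
    (μ : Measure X) [SigmaFinite μ] (i : ℕ) :
    IsFiniteMeasure (μ.restrict (disjointed (spanningSets μ) i)) :=
  ⟨by
    rw [Measure.restrict_apply_univ]
    exact (measure_mono (disjointed_subset _ _)).trans_lt (measure_spanningSets_lt_top μ i)⟩

attribute [instance] isProbabilityMeasure_finitePoisson isProbabilityMeasure_poissonLaw

/-- Independence of the pieces factorises the functional over finitely many of them; the exponents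
then add up to an integral over the whole space. -/
theorem hasLaplace_poissonLaw {X : Type*} [MeasurableSpace X] (μ : Measure X) [SigmaFinite μ] :
    HasLaplace (poissonLaw μ) μ := by
  intro f hf
  have hm : Measurable fun ω : Config X => expNeg (∫⁻ y, f y ∂ω.1) :=
    measurable_expNeg.comp (measurable_config_lintegral hf)
  rw [poissonLaw, lintegral_map hm measurable_superpose]
  simp only [lintegral_superpose, expNeg_tsum]
  rw [lintegral_iInf]
  · have hprod : ∀ N, ∫⁻ ω : ℕ → Config X, ∏ i ∈ Finset.range N, expNeg (∫⁻ y, f y ∂(ω i).1)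
        ∂(Measure.infinitePi fun i : ℕ =>
          finitePoisson (μ.restrict (disjointed (spanningSets μ) i))) =
        ∏ i ∈ Finset.range N,
          expNeg (∫⁻ x in disjointed (spanningSets μ) i, (1 - expNeg (f x)) ∂μ) := fun N => by
      rw [ProbabilityTheory.lintegral_prod_eq_prod_lintegral_of_indepFun (Finset.range N)
        (fun i (ω : ℕ → Config X) => expNeg (∫⁻ y, f y ∂(ω i).1))
        (ProbabilityTheory.iIndepFun_infinitePi
          (X := fun _ (ω : Config X) => expNeg (∫⁻ y, f y ∂ω.1)) fun _ => hm)
        fun i => hm.comp (measurable_pi_apply i)]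
      refine Finset.prod_congr rfl fun i _ => ?_
      rw [← hasLaplace_finitePoisson _ f hf, ← Measure.infinitePi_map_eval
        (fun i : ℕ => finitePoisson (μ.restrict (disjointed (spanningSets μ) i))) i,
        lintegral_map hm (measurable_pi_apply i)]
    simp only [hprod]
    rw [← expNeg_tsum, ← lintegral_iUnion
      (fun i => MeasurableSet.disjointed (measurableSet_spanningSets μ) i)
      (disjoint_disjointed _), iUnion_disjointed, iUnion_spanningSets, setLIntegral_univ]
  · exact fun N => Finset.measurable_prod _ fun i _ => hm.comp (measurable_pi_apply i)
  · intro m n hmn ω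
    exact Finset.prod_le_prod_of_subset_of_le_one' (by simpa using hmn)
      fun i _ _ => expNeg_le_one _
  · simp

theorem HasLaplace.map_suspension {X : Type*} [MeasurableSpace X] {P : Measure (Config X)}
    {μ : Measure X} (h : HasLaplace P μ) (T : X ≃ᵐ X) :
    HasLaplace (P.map (suspension T)) (μ.map T) := by
  intro f hf
  have hm : Measurable fun ω : Config X => expNeg (∫⁻ y, f y ∂ω.1) :=
    measurable_expNeg.comp (measurable_config_lintegral hf)
  have hm' : Measurable fun x => 1 - expNeg (f x) :=
    measurable_const.sub (measurable_expNeg.comp hf)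
  rw [lintegral_map hm (suspension T).measurable, lintegral_map hm' T.measurable,
    ← h (fun x => f (T x)) (hf.comp T.measurable)]
  refine lintegral_congr fun ω => ?_
  change expNeg (∫⁻ y, f y ∂(ω.1.map T)) = _
  rw [lintegral_map hf T.measurable]

theorem HasLaplace.map_suspension_iterate {X : Type*} [MeasurableSpace X] {P : Measure (Config X)}
    {μ : Measure X} (h : HasLaplace P μ) (T : X ≃ᵐ X) (n : ℕ) :
    HasLaplace (P.map (suspension T)^[n]) (μ.map T^[n]) := by
  induction n with
  | zero => simpa using h
  | succ n ih =>
    have := ih.map_suspension T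
    rwa [Measure.map_map (suspension T).measurable ((suspension T).measurable.iterate n),
      Measure.map_map T.measurable (T.measurable.iterate n), ← Function.iterate_succ',
      ← Function.iterate_succ'] at this

/-! ### The Laplace functional determines the law -/

theorem log_expNeg (x : ℝ≥0∞) : (-(ENNReal.log (expNeg x))).toENNReal = x := by
  rw [expNeg, EReal.log_exp, neg_neg, EReal.toENNReal_coe]

/-- A family of measurable maps to the unit interval whose monomials have the same integrals with
respect to two finite measures has the same joint law under both. -/
theorem map_eq_of_integral_monomial_eq {Ω ι : Type*} [MeasurableSpace Ω] [Fintype ι]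
    {P Q : Measure Ω} [IsFiniteMeasure P] [IsFiniteMeasure Q] (Y : Ω → ι → unitInterval)
    (hY : Measurable Y) (C : Set (Ω → ℝ)) (h1 : (fun _ => 1) ∈ C)
    (hmul : ∀ f ∈ C, ∀ g ∈ C, (fun ω => f ω * g ω) ∈ C)
    (hcoord : ∀ i, (fun ω => (Y ω i : ℝ)) ∈ C)
    (hC : ∀ f ∈ C, ∫ ω, f ω ∂P = ∫ ω, f ω ∂Q) : P.map Y = Q.map Y := by
  let c : ι → BoundedContinuousFunction (ι → unitInterval) ℝ := fun i =>
    BoundedContinuousFunction.mkOfCompact ⟨fun y => (y i : ℝ), by fun_prop⟩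
  have hstar : star (range c) = range c := by
    have : ∀ g : BoundedContinuousFunction (ι → unitInterval) ℝ, star g = g := fun g => by
      ext x; simp
    ext g
    simp [Set.mem_star, this]
  have hclosure : ∀ g ∈ Submonoid.closure (range c), (fun ω => g (Y ω)) ∈ C := by
    intro g hg
    induction hg using Submonoid.closure_induction with
    | mem x hx => obtain ⟨i, rfl⟩ := hx; exact hcoord i
    | one => exact h1
    | mul x y _ _ hx hy => exact hmul _ hx _ hy
  have hint : ∀ (R : Measure (ι → unitInterval)) [IsFiniteMeasure R]
      (g : BoundedContinuousFunction (ι → unitInterval) ℝ), Integrable g R :=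
    fun R _ g => g.integrable R
  -- It suffices to compare integrals on a subalgebra that separates points. The one generated by
  -- the coordinates is spanned by monomials, and these pull back into `C`.
  refine ext_of_forall_mem_subalgebra_integral_eq_of_polish
    (𝕜 := ℝ) (A := StarAlgebra.adjoin ℝ (range c)) ?_ ?_
  · intro x y hxy
    obtain ⟨i, hi⟩ := Function.ne_iff.1 hxy
    refine ⟨fun z => (z i : ℝ), ?_, fun h => hi (Subtype.ext h)⟩
    refine ⟨⟨fun z => (z i : ℝ), by fun_prop⟩, ?_, rfl⟩
    exact ⟨c i, StarAlgebra.subset_adjoin ℝ _ ⟨i, rfl⟩, rfl⟩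
  · intro g hg
    have hg' : g ∈ Submodule.span ℝ
        (Submonoid.closure (range c) : Set (BoundedContinuousFunction (ι → unitInterval) ℝ)) := by
      have := StarAlgebra.adjoin_eq_span (R := ℝ) (range c)
      rw [hstar, union_self] at this
      rw [← this]
      exact hg
    clear hg
    induction hg' using Submodule.span_induction with
    | mem x hx =>
      have hs := fun R : Measure Ω => integral_map (μ := R) hY.aemeasurable (f := x)
        x.continuous.aestronglyMeasurable
      rw [hs, hs]
      exact hC _ (hclosure x hx)
    | zero => simp
    | add x y _ _ hx hy =>
      simp only [BoundedContinuousFunction.coe_add, Pi.add_apply]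
      rw [integral_add (hint _ x) (hint _ y), integral_add (hint _ x) (hint _ y), hx, hy]
    | smul a x _ hx =>
      simp only [BoundedContinuousFunction.coe_smul]
      rw [integral_smul, integral_smul, hx]

/-- A finite measure on the configuration space is determined by its Laplace functional. -/
theorem ext_of_lintegral_expNeg {X : Type*} [MeasurableSpace X] {P Q : Measure (Config X)}
    [IsFiniteMeasure P] [IsFiniteMeasure Q]
    (h : ∀ f : X → ℝ≥0∞, Measurable f →
      ∫⁻ ω, expNeg (∫⁻ y, f y ∂ω.1) ∂P = ∫⁻ ω, expNeg (∫⁻ y, f y ∂ω.1) ∂Q) : P = Q := by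
  have hmem : ∀ x : ℝ≥0∞, (expNeg x).toReal ∈ unitInterval := fun x =>
    ⟨ENNReal.toReal_nonneg, by
      simpa using ENNReal.toReal_mono ENNReal.one_ne_top (expNeg_le_one x)⟩
  -- A configuration is encoded by the numbers `e^{-ω(s)}`, which stay bounded even where `ω(s) =
  -- ∞`.
  let Y : Config X → {s : Set X // MeasurableSet s} → unitInterval := fun ω s =>
    ⟨(expNeg (ω.1 s.1)).toReal, hmem _⟩
  have hev : ∀ s : Set X, MeasurableSet s → Measurable fun ω : Config X => ω.1 s := fun s hs =>
    (Measure.measurable_coe hs).comp measurable_subtype_coe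
  have hY : Measurable Y := measurable_pi_lambda _ fun s =>
    ((measurable_expNeg.comp (hev s.1 s.2)).ennreal_toReal).subtype_mk
  -- No information is lost: `ω(s)` is recovered from its code as `-log`.
  have hle : (inferInstance : MeasurableSpace (Config X)) ≤
      MeasurableSpace.comap Y inferInstance := by
    have hval : Measurable[MeasurableSpace.comap Y inferInstance]
        (Subtype.val : Config X → Measure X) := by
      refine Measure.measurable_of_measurable_coe _ fun s hs => ?_
      have hL : Measurable fun y : {s : Set X // MeasurableSet s} → unitInterval =>
          (-(ENNReal.log (ENNReal.ofReal (y ⟨s, hs⟩ : ℝ)))).toENNReal := by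
        refine measurable_ereal_toENNReal.comp (measurable_neg.comp
          (ENNReal.measurable_log.comp (ENNReal.measurable_ofReal.comp ?_)))
        exact measurable_subtype_coe.comp (measurable_pi_apply _)
      convert hL.comp (comap_measurable Y) using 1
      funext ω
      change ω.1 s = (-(ENNReal.log (ENNReal.ofReal (expNeg (ω.1 s)).toReal))).toENNReal
      rw [ENNReal.ofReal_toReal (expNeg_ne_top _), log_expNeg]
    exact hval.comap_le
  have hmap : P.map Y = Q.map Y := by
    -- The index set may be uncountable, but a finite measure on the product is determined by its
    -- finite-dimensional marginals.
    refine IsProjectiveLimit.unique (P := fun J => (P.map Y).map J.restrict) (fun J => rfl)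
      fun J => ?_
    change _ = (P.map Y).map J.restrict
    rw [Measure.map_map (Finset.measurable_restrict J) hY,
      Measure.map_map (Finset.measurable_restrict J) hY]
    symm
    -- The functions `ω ↦ e^{-ω(f)}` are closed under products because exponents add; the
    -- coordinates of `Y` come from indicators `f`.
    refine map_eq_of_integral_monomial_eq _ ((Finset.measurable_restrict J).comp hY)
      {g | ∃ f : X → ℝ≥0∞, Measurable f ∧ g = fun ω : Config X => (expNeg (∫⁻ y, f y ∂ω.1)).toReal}
      ⟨0, measurable_const, by simp [expNeg_zero]⟩ ?_ ?_ ?_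
    · rintro _ ⟨f, hf, rfl⟩ _ ⟨g, hg, rfl⟩
      refine ⟨fun x => f x + g x, hf.add hg, funext fun ω => ?_⟩
      rw [lintegral_add_left hf, expNeg_add, ENNReal.toReal_mul]
    · rintro ⟨s, hs⟩
      refine ⟨s.1.indicator 1, measurable_one.indicator s.2, funext fun ω => ?_⟩
      rw [lintegral_indicator_one s.2]
      rfl
    · rintro _ ⟨f, hf, rfl⟩
      have hm : Measurable fun ω : Config X => expNeg (∫⁻ y, f y ∂ω.1) :=
        measurable_expNeg.comp (measurable_config_lintegral hf)
      rw [integral_toReal hm.aemeasurable (ae_of_all _ fun _ => (expNeg_ne_top _).lt_top),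
        integral_toReal hm.aemeasurable (ae_of_all _ fun _ => (expNeg_ne_top _).lt_top), h f hf]
  ext s hs
  obtain ⟨B, hB, rfl⟩ := hle s hs
  rw [← Measure.map_apply hY hB, ← Measure.map_apply hY hB, hmap]

/-! ### Wandering sets and Hopf's criterion -/

theorem perm_zpow_measurable {Y : Type*} [MeasurableSpace Y] (S : Y ≃ᵐ Y) (n : ℤ) :
    Measurable ⇑((S.toEquiv : Equiv.Perm Y) ^ n) := by
  have hpow : ∀ (R : Y ≃ᵐ Y) (k : ℕ), Measurable ⇑((R.toEquiv : Equiv.Perm Y) ^ k) :=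
    fun R k => by
      rw [Equiv.Perm.coe_pow]
      exact R.measurable.iterate k
  obtain ⟨k, rfl | rfl⟩ := n.eq_nat_or_neg
  · simpa using hpow S k
  · have := hpow S.symm k
    rw [zpow_neg, zpow_natCast, ← inv_pow]
    exact this

theorem measurableSet_image_perm_zpow {Y : Type*} [MeasurableSpace Y] (S : Y ≃ᵐ Y) (n : ℤ)
    {B : Set Y} (hB : MeasurableSet B) :
    MeasurableSet (((S.toEquiv : Equiv.Perm Y) ^ n) '' B) := by
  rw [Equiv.image_eq_preimage_symm]
  have := perm_zpow_measurable S (-n) hB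
  rwa [zpow_neg] at this

/-- Countably many wandering sets can be replaced by one wandering set with the same saturation. -/
theorem exists_wandering_of_seq {Y : Type*} [MeasurableSpace Y] (S : Y ≃ᵐ Y) {B : ℕ → Set Y}
    (hBm : ∀ M, MeasurableSet (B M))
    (hB : ∀ M, ∀ w ∈ B M, ∀ j : ℕ, j ≠ 0 → S^[j] w ∉ B M) :
    ∃ W : Set Y, MeasurableSet W ∧
      Pairwise (fun m n : ℤ => Disjoint (((S.toEquiv : Equiv.Perm Y) ^ m) '' W)
        (((S.toEquiv : Equiv.Perm Y) ^ n) '' W)) ∧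
      ∀ M, B M ⊆ ⋃ n : ℤ, ((S.toEquiv : Equiv.Perm Y) ^ n) '' W := by
  set p : Equiv.Perm Y := S.toEquiv with hp
  let D : ℕ → Set Y := fun M => ⋃ n : ℤ, (p ^ n) '' B M
  have hD : ∀ M x, x ∈ D M ↔ ∃ n : ℤ, ∃ w ∈ B M, (p ^ n) w = x := fun M x => by
    simp only [D, mem_iUnion, mem_image]
  have hDinv : ∀ M x (n : ℤ), x ∈ D M → (p ^ n) x ∈ D M := by
    intro M x n hx
    obtain ⟨m, w, hw, rfl⟩ := (hD M x).1 hx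
    exact (hD M _).2 ⟨n + m, w, hw, by rw [zpow_add, Equiv.Perm.mul_apply]⟩
  have hzB : ∀ M, ∀ w ∈ B M, ∀ j : ℤ, j ≠ 0 → (p ^ j) w ∉ B M := by
    intro M w hw j hj hmem
    obtain ⟨k, rfl | rfl⟩ := j.eq_nat_or_neg
    · rw [zpow_natCast, Equiv.Perm.coe_pow] at hmem
      exact hB M w hw k (by simpa using hj) hmem
    · refine hB M _ hmem k (by simpa using hj) ?_
      have : S^[k] ((p ^ (-(k : ℤ))) w) = w := by
        change p^[k] _ = w
        rw [← Equiv.Perm.coe_pow, ← zpow_natCast, ← Equiv.Perm.mul_apply, ← zpow_add]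
        simp
      rwa [this]
  -- Each orbit is served only by the first `B M` it meets: the invariant saturations `D k` of the
  -- earlier sets are removed.
  refine ⟨⋃ M, B M \ ⋃ k ∈ Iio M, D k, ?_, ?_, ?_⟩
  · refine MeasurableSet.iUnion fun M => (hBm M).diff (MeasurableSet.biUnion (to_countable _)
      fun k _ => MeasurableSet.iUnion fun n => measurableSet_image_perm_zpow S n (hBm k))
  · intro m n hmn
    rw [Set.disjoint_left]
    rintro x ⟨w, hw, rfl⟩ ⟨w', hw', heq⟩
    obtain ⟨M, hwM, hwn⟩ := mem_iUnion.1 hw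
    obtain ⟨M', hwM', hwn'⟩ := mem_iUnion.1 hw'
    simp only [mem_iUnion, mem_Iio, not_exists] at hwn hwn'
    have h1 : w = (p ^ (n - m)) w' := by
      rw [sub_eq_neg_add, zpow_add, Equiv.Perm.mul_apply, heq, ← Equiv.Perm.mul_apply, ← zpow_add]
      simp
    have h2 : w' = (p ^ (m - n)) w := by
      rw [h1, ← Equiv.Perm.mul_apply, ← zpow_add]; simp
    have hMM : M = M' := by
      rcases lt_trichotomy M M' with h | h | h
      · exact absurd ((hD M w').2 ⟨_, w, hwM, h2.symm⟩) (hwn' M h)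
      · exact h
      · exact absurd ((hD M' w).2 ⟨_, w', hwM', h1.symm⟩) (hwn M' h)
    subst hMM
    refine hzB M w hwM (m - n) (sub_ne_zero.2 hmn) ?_
    rwa [← h2]
  · intro M x hx
    classical
    have hex : ∃ k, x ∈ D k := ⟨M, (hD M x).2 ⟨0, x, hx, by simp⟩⟩
    obtain ⟨n, w, hw, hwx⟩ := (hD _ x).1 (Nat.find_spec hex)
    refine mem_iUnion.2 ⟨n, w, mem_iUnion.2 ⟨Nat.find hex, hw, ?_⟩, hwx⟩
    simp only [mem_iUnion, mem_Iio, not_exists]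
    intro k hk hwk
    exact Nat.find_min hex hk (hwx ▸ hDinv k w n hwk)

/-- Hopf's criterion: the images `Sⁿ⁺¹` of the measure are given by densities whose sum is either
almost everywhere infinite, and then `S` is conservative, or almost everywhere finite, and then
`S` is totally dissipative. -/
theorem conservative_or_totallyDissipative {Y : Type*} [MeasurableSpace Y] (S : Y ≃ᵐ Y)
    (ν : Measure Y) [IsProbabilityMeasure ν] (hS : IsNonsingular S ν) {h : ℕ → Y → ℝ≥0∞}
    (hm : ∀ n, Measurable (h n)) (hd : ∀ n, ν.map S^[n + 1] = ν.withDensity (h n))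
    (h01 : (∀ᵐ y ∂ν, ∑' n, h n y = ∞) ∨ ∀ᵐ y ∂ν, ∑' n, h n y ≠ ∞) :
    Conservative S ν ∨ IsTotallyDissipative S ν := by
  have hsm : Measurable fun y => ∑' n, h n y := Measurable.tsum hm
  have hint : ∀ A, MeasurableSet A →
      ∫⁻ y in A, ∑' n, h n y ∂ν = ∑' n, ν (S^[n + 1] ⁻¹' A) := fun A hA => by
    rw [lintegral_tsum fun n => (hm n).aemeasurable]
    refine tsum_congr fun n => ?_
    rw [← withDensity_apply _ hA, ← hd n, Measure.map_apply (S.measurable.iterate _) hA]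
  rcases h01 with hinf | hfin
  · left
    refine ⟨⟨S.measurable, hS.absolutelyContinuous_map⟩, fun A hA hA0 => ?_⟩
    by_contra! hcon
    -- If no point of `A` returned to `A`, its preimages would be disjoint. The integral of the sum
    -- over `A` would then be finite, although the integrand is infinite.
    have hdisj : Pairwise (Function.onFun Disjoint fun n => S^[n + 1] ⁻¹' A) := by
      have key : ∀ m n, m < n → Disjoint (S^[m + 1] ⁻¹' A) (S^[n + 1] ⁻¹' A) := by
        intro m n hmn
        rw [Set.disjoint_left]
        intro x hx hx'
        refine hcon _ hx (n - m) (by omega) ?_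
        rw [← Function.iterate_add_apply]
        rwa [show n - m + (m + 1) = n + 1 by omega]
      intro m n hmn
      rcases lt_or_gt_of_ne hmn with h | h
      · exact key m n h
      · exact (key n m h).symm
    have hle : ∫⁻ y in A, ∑' n, h n y ∂ν ≠ ∞ := by
      rw [hint A hA, ← measure_iUnion hdisj fun n => S.measurable.iterate _ hA]
      exact measure_ne_top _ _
    refine hA0 ?_
    have h1 := ae_lt_top hsm hle
    have h2 : ∀ᵐ y ∂ν.restrict A, False := by
      filter_upwards [h1, ae_restrict_of_ae hinf] with y hy hy'
      simp [hy'] at hy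
    simpa [ae_iff] using h2
  · right
    refine ⟨hS, ?_⟩
    let A : ℕ → Set Y := fun M => {y | ∑' n, h n y ≤ M}
    have hAmem : ∀ M y, y ∈ A M ↔ ∑' n, h n y ≤ M := fun M y => by simp only [A, mem_ofPred_eq]
    have hA : ∀ M, MeasurableSet (A M) := fun M => measurableSet_le hsm measurable_const
    -- The points of `A M` that never return to `A M`, that is, those at their last visit; such a
    -- set is wandering.
    let B : ℕ → Set Y := fun M => A M \ ⋃ n, S^[n + 1] ⁻¹' A M
    have hBm : ∀ M, MeasurableSet (B M) := fun M =>
      (hA M).diff (MeasurableSet.iUnion fun n => S.measurable.iterate _ (hA M))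
    obtain ⟨W, hW, hdisj, hcov⟩ := exists_wandering_of_seq S hBm (by
      intro M w hw j hj hmem
      refine hw.2 (mem_iUnion.2 ⟨j - 1, ?_⟩)
      rw [mem_preimage, Nat.sub_add_cancel (Nat.pos_of_ne_zero hj)]
      exact hmem.1)
    refine ⟨W, hW, hdisj, ?_⟩
    -- Borel-Cantelli: the measures of the preimages of `A M` sum to the integral of `∑ hₙ` over `A
    -- M`, which is at most `M`. So almost every orbit has a last visit.
    have hvis : ∀ᵐ y ∂ν, ∀ M, ∀ᶠ n in atTop, y ∉ S^[n + 1] ⁻¹' A M := by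
      refine ae_all_iff.2 fun M => ae_eventually_notMem ?_
      rw [← hint _ (hA M)]
      refine ((setLIntegral_mono measurable_const (g := fun _ => (M : ℝ≥0∞))
        fun y hy => (hAmem M y).1 hy).trans_lt ?_).ne
      rw [setLIntegral_const]
      exact ENNReal.mul_lt_top (by simp) (measure_lt_top _ _)
    rw [← mem_ae_iff]
    filter_upwards [hfin, hvis] with y hy hy'
    obtain ⟨M, hM⟩ := exists_nat_gt (∑' n, h n y).toReal
    have hyM : y ∈ A M := by
      rw [hAmem, ← ENNReal.ofReal_toReal hy, ← ENNReal.ofReal_natCast]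
      exact ENNReal.ofReal_le_ofReal hM.le
    obtain ⟨N, hN⟩ := eventually_atTop.1 (hy' M)
    classical
    -- The time of the last visit of `y` to `A M`: time `0` is a visit, and there are none after
    -- time `N`.
    let n := Nat.findGreatest (fun k => S^[k] y ∈ A M) (N + 1)
    have hn : S^[n] y ∈ A M :=
      Nat.findGreatest_spec (P := fun k => S^[k] y ∈ A M) (Nat.zero_le _) hyM
    have hnB : S^[n] y ∈ B M := by
      refine ⟨hn, fun hmem => ?_⟩
      obtain ⟨k, hk⟩ := mem_iUnion.1 hmem
      rw [mem_preimage, ← Function.iterate_add_apply] at hk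
      have hk' : S^[(k + n) + 1] y ∈ A M := by rwa [show k + n + 1 = k + 1 + n by ring]
      have hlt : k + n < N := by
        by_contra hge
        exact hN _ (not_lt.1 hge) hk'
      have := Nat.le_findGreatest (P := fun k => S^[k] y ∈ A M) (n := N + 1) (by omega) hk'
      change k + n + 1 ≤ n at this
      omega
    obtain ⟨m, w, hw, hwx⟩ := mem_iUnion.1 (hcov M hnB)
    refine mem_iUnion.2 ⟨-(n : ℤ) + m, w, hw, ?_⟩
    rw [zpow_add, Equiv.Perm.mul_apply, hwx]
    change ((S.toEquiv : Equiv.Perm Y) ^ (-(n : ℤ))) ((S.toEquiv : Equiv.Perm Y)^[n] y) = y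
    rw [← Equiv.Perm.coe_pow, ← zpow_natCast, ← Equiv.Perm.mul_apply, ← zpow_add]
    simp

/-! ### Densities between Poisson laws -/

theorem one_sub_expNeg_le (x : ℝ≥0∞) : 1 - expNeg x ≤ x := by
  rcases eq_or_ne x ∞ with rfl | hx
  · exact le_top
  · rw [← ENNReal.ofReal_toReal hx, expNeg_ofReal ENNReal.toReal_nonneg, ← ENNReal.ofReal_one,
      ← ENNReal.ofReal_sub _ (Real.exp_pos _).le]
    refine ENNReal.ofReal_le_ofReal ?_
    linarith [Real.add_one_le_exp (-x.toReal)]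

/-- `ENNReal.ofReal` truncates at zero, so the exponent is the negative part of `log t`. The next
lemma treats the positive part, with the same outcome `min t 1`; this is what makes the two tilts in
`exists_density` meet. -/
theorem expNeg_ofReal_neg_log {t : ℝ} (ht : 0 < t) :
    expNeg (ENNReal.ofReal (-Real.log t)) = ENNReal.ofReal (min t 1) := by
  rcases le_total t 1 with h | h
  · rw [expNeg_ofReal (by linarith [Real.log_nonpos ht.le h]), neg_neg, Real.exp_log ht,
      min_eq_left h]
  · rw [ENNReal.ofReal_of_nonpos (by linarith [Real.log_nonneg h]), expNeg_zero, min_eq_right h,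
      ENNReal.ofReal_one]

theorem ofReal_mul_expNeg_ofReal_log {t : ℝ} (ht : 0 < t) :
    ENNReal.ofReal t * expNeg (ENNReal.ofReal (Real.log t)) = ENNReal.ofReal (min t 1) := by
  have h := expNeg_ofReal_neg_log (inv_pos.2 ht)
  rw [Real.log_inv, neg_neg] at h
  rw [h, ← ENNReal.ofReal_mul ht.le, mul_min_of_nonneg _ _ ht.le, mul_inv_cancel₀ ht.ne', mul_one,
    min_comm]

namespace HasLaplace

variable {X : Type*} [MeasurableSpace X] {P : Measure (Config X)} {μ : Measure X}

/-- The Laplace functional of an exponentially tilted Poisson law. -/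
theorem lintegral_mul_expNeg (h : HasLaplace P μ) {f g : X → ℝ≥0∞} (hf : Measurable f)
    (hg : Measurable g) :
    ∫⁻ ω, expNeg (∫⁻ y, g y ∂ω.1) * expNeg (∫⁻ y, f y ∂ω.1) ∂P =
      expNeg (∫⁻ x, (1 - expNeg (g x)) ∂μ) *
        expNeg (∫⁻ x, expNeg (g x) * (1 - expNeg (f x)) ∂μ) := by
  have h1 := h (fun x => g x + f x) (hg.add hf)
  have hmg : Measurable fun x => 1 - expNeg (g x) :=
    measurable_const.sub (measurable_expNeg.comp hg)
  rw [← expNeg_add, ← lintegral_add_left hmg]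
  calc _ = ∫⁻ ω, expNeg (∫⁻ y, (g y + f y) ∂ω.1) ∂P := by
        refine lintegral_congr fun ω => ?_
        rw [lintegral_add_left hg, expNeg_add]
    _ = _ := by
      rw [h1]
      congr 1
      refine lintegral_congr fun x => ?_
      -- Pointwise, `1 - e^{-(g+f)} = (1 - e^{-g}) + e^{-g} (1 - e^{-f})`.
      rw [expNeg_add, ENNReal.mul_sub fun _ _ => expNeg_ne_top _, mul_one,
        tsub_add_tsub_cancel (expNeg_le_one _) (mul_le_of_le_one_right' (expNeg_le_one _))]

/-- The normalised exponential tilt of a Poisson law by `g` has the Laplace functional of the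
Poisson law of intensity `e^{-g} μ`. -/
theorem lintegral_withDensity_expNeg (h : HasLaplace P μ) {f g : X → ℝ≥0∞} (hf : Measurable f)
    (hg : Measurable g) (hc : expNeg (∫⁻ x, (1 - expNeg (g x)) ∂μ) ≠ 0) :
    ∫⁻ ω, expNeg (∫⁻ y, f y ∂ω.1) ∂(P.withDensity fun ω =>
        (expNeg (∫⁻ x, (1 - expNeg (g x)) ∂μ))⁻¹ * expNeg (∫⁻ y, g y ∂ω.1)) =
      expNeg (∫⁻ x, expNeg (g x) * (1 - expNeg (f x)) ∂μ) := by
  have hF : Measurable fun ω : Config X => expNeg (∫⁻ y, f y ∂ω.1) :=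
    measurable_expNeg.comp (measurable_config_lintegral hf)
  have hG : Measurable fun ω : Config X => expNeg (∫⁻ y, g y ∂ω.1) :=
    measurable_expNeg.comp (measurable_config_lintegral hg)
  have hFG : Measurable fun ω : Config X =>
      expNeg (∫⁻ y, g y ∂ω.1) * expNeg (∫⁻ y, f y ∂ω.1) := hG.mul hF
  rw [lintegral_withDensity_eq_lintegral_mul _ (hG.const_mul _) hF]
  simp only [Pi.mul_apply, mul_assoc]
  rw [lintegral_const_mul _ hFG, h.lintegral_mul_expNeg hf hg, ← mul_assoc,
    ENNReal.inv_mul_cancel hc (expNeg_ne_top _), one_mul]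

/-- With `G(ω) = ∫ g dω`, the expectation of `e^{-G/k}` is at most `1 - P(G = ∞)`. The Laplace
functional bounds it below by `e^{-(∫ g dμ)/k}`, which tends to `1`. -/
theorem ae_lintegral_ne_top (h : HasLaplace P μ) [IsProbabilityMeasure P] {g : X → ℝ≥0∞}
    (hg : Measurable g) (hint : ∫⁻ x, g x ∂μ ≠ ∞) : ∀ᵐ ω ∂P, ∫⁻ y, g y ∂ω.1 ≠ ∞ := by
  have hms : MeasurableSet {ω : Config X | ∫⁻ y, g y ∂ω.1 = ∞} :=
    measurable_config_lintegral hg (measurableSet_singleton ∞)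
  have hkey : ∀ k : ℕ, expNeg ((k : ℝ≥0∞)⁻¹ * ∫⁻ x, g x ∂μ) +
      P {ω : Config X | ∫⁻ y, g y ∂ω.1 = ∞} ≤ 1 := by
    intro k
    have hgk : Measurable fun x => (k : ℝ≥0∞)⁻¹ * g x := hg.const_mul _
    calc _ ≤ expNeg (∫⁻ x, (1 - expNeg ((k : ℝ≥0∞)⁻¹ * g x)) ∂μ) +
          ∫⁻ ω, {ω : Config X | ∫⁻ y, g y ∂ω.1 = ∞}.indicator 1 ω ∂P := by
          rw [lintegral_indicator_one hms, ← lintegral_const_mul _ hg]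
          gcongr
          exact expNeg_antitone (lintegral_mono fun x => one_sub_expNeg_le _)
      _ = ∫⁻ ω, (expNeg (∫⁻ y, (k : ℝ≥0∞)⁻¹ * g y ∂ω.1) +
            {ω : Config X | ∫⁻ y, g y ∂ω.1 = ∞}.indicator 1 ω) ∂P := by
          have hm : Measurable fun ω : Config X => expNeg (∫⁻ y, (k : ℝ≥0∞)⁻¹ * g y ∂ω.1) :=
            measurable_expNeg.comp (measurable_config_lintegral hgk)
          rw [← h _ hgk, lintegral_add_left hm]
      _ ≤ ∫⁻ ω, 1 ∂P := by
          refine lintegral_mono fun ω => ?_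
          by_cases hω : ∫⁻ y, g y ∂ω.1 = ∞
          · rw [lintegral_const_mul _ hg, hω, ENNReal.mul_top (by simp), expNeg_top, zero_add]
            exact indicator_le_self' (fun _ _ => zero_le_one) ω
          · rw [indicator_of_notMem (by simpa using hω), add_zero]
            exact expNeg_le_one _
      _ = 1 := by simp
  have hlim : Tendsto (fun k : ℕ => expNeg ((k : ℝ≥0∞)⁻¹ * ∫⁻ x, g x ∂μ) +
      P {ω : Config X | ∫⁻ y, g y ∂ω.1 = ∞}) atTop
      (nhds (1 + P {ω : Config X | ∫⁻ y, g y ∂ω.1 = ∞})) := by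
    refine Tendsto.add_const _ ?_
    have h1 : Tendsto (fun k : ℕ => (k : ℝ≥0∞)⁻¹ * ∫⁻ x, g x ∂μ) atTop (nhds 0) := by
      simpa using ENNReal.Tendsto.mul_const ENNReal.tendsto_inv_nat_nhds_zero (Or.inr hint)
    simpa [expNeg_zero, Function.comp_def] using (continuous_expNeg.tendsto 0).comp h1
  have hle := le_of_tendsto' hlim hkey
  have h0 : P {ω : Config X | ∫⁻ y, g y ∂ω.1 = ∞} = 0 := by
    have : 1 + P {ω : Config X | ∫⁻ y, g y ∂ω.1 = ∞} ≤ 1 + 0 := by simpa using hle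
    simpa using (ENNReal.add_le_add_iff_left ENNReal.one_ne_top).1 this
  simpa [ae_iff] using h0

/-- If `Q` is Poisson with intensity `φ μ`, where `φ` is bounded and bounded away from zero and
`φ - 1` is integrable, then `Q` has an explicit density with respect to the Poisson law `P` of
intensity `μ`, namely `ω ↦ k ∏_{x ∈ ω} φ x`. -/
theorem exists_density {Q : Measure (Config X)} [IsProbabilityMeasure P] [IsProbabilityMeasure Q]
    (hP : HasLaplace P μ) {φ : X → ℝ} (hφ : Measurable φ) {α : ℝ} (hα : 1 < α)
    (hlow : ∀ x, α⁻¹ ≤ φ x) (hup : ∀ x, φ x ≤ α)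
    (hQ : HasLaplace Q (μ.withDensity fun x => ENNReal.ofReal (φ x)))
    (hint : ∫⁻ x, ‖φ x - 1‖ₑ ∂μ ≠ ∞) :
    ∃ (k : ℝ≥0∞) (g₁ g₂ : X → ℝ≥0∞), k ≠ 0 ∧ Measurable g₁ ∧ Measurable g₂ ∧
      (∀ x, g₁ x ≤ ENNReal.ofReal (Real.log α)) ∧ (∀ x, g₂ x ≤ ENNReal.ofReal (Real.log α)) ∧
      (∀ᵐ ω ∂P, ∫⁻ y, g₁ y ∂ω.1 ≠ ∞) ∧
      Q = P.withDensity fun ω =>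
        k * (expNeg (∫⁻ y, g₁ y ∂ω.1) * (expNeg (∫⁻ y, g₂ y ∂ω.1))⁻¹) := by
  have hα0 : 0 < α := by linarith
  have hpos : ∀ x, 0 < φ x := fun x => (inv_pos.2 hα0).trans_le (hlow x)
  -- The negative and positive parts of `log φ`. Tilting only by nonnegative functions keeps every
  -- factor in `[0, 1]`.
  set g₁ : X → ℝ≥0∞ := fun x => ENNReal.ofReal (-Real.log (φ x)) with hg₁
  set g₂ : X → ℝ≥0∞ := fun x => ENNReal.ofReal (Real.log (φ x)) with hg₂
  have hm₁ : Measurable g₁ := (Real.measurable_log.comp hφ).neg.ennreal_ofReal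
  have hm₂ : Measurable g₂ := (Real.measurable_log.comp hφ).ennreal_ofReal
  have hE₁ : ∀ x, expNeg (g₁ x) = ENNReal.ofReal (min (φ x) 1) := fun x =>
    expNeg_ofReal_neg_log (hpos x)
  have hE₂ : ∀ x, ENNReal.ofReal (φ x) * expNeg (g₂ x) = ENNReal.ofReal (min (φ x) 1) := fun x =>
    ofReal_mul_expNeg_ofReal_log (hpos x)
  -- From `-log φ ≤ φ⁻¹ - 1 = φ⁻¹ (1 - φ)` and `φ⁻¹ ≤ α`.
  have hle₁ : ∀ x, g₁ x ≤ ENNReal.ofReal α * ‖φ x - 1‖ₑ := fun x => by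
    rw [Real.enorm_eq_ofReal_abs, ← ENNReal.ofReal_mul hα0.le]
    refine ENNReal.ofReal_le_ofReal ?_
    have h1 := Real.log_le_sub_one_of_pos (inv_pos.2 (hpos x))
    rw [Real.log_inv] at h1
    have h2 : (φ x)⁻¹ - 1 = (φ x)⁻¹ * (1 - φ x) := by
      rw [mul_sub, inv_mul_cancel₀ (hpos x).ne', mul_one]
    have h3 : (φ x)⁻¹ ≤ α := inv_le_of_inv_le₀ hα0 (hlow x)
    have h4 : (φ x)⁻¹ * (1 - φ x) ≤ (φ x)⁻¹ * |φ x - 1| := by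
      refine mul_le_mul_of_nonneg_left ?_ (inv_pos.2 (hpos x)).le
      rw [abs_sub_comm]
      exact le_abs_self _
    have h5 := mul_le_mul_of_nonneg_right h3 (abs_nonneg (φ x - 1))
    linarith
  have hle₂ : ∀ x, g₂ x ≤ ‖φ x - 1‖ₑ := fun x => by
    rw [Real.enorm_eq_ofReal_abs]
    exact ENNReal.ofReal_le_ofReal
      ((Real.log_le_sub_one_of_pos (hpos x)).trans (le_abs_self _))
  have hi₁ : ∫⁻ x, g₁ x ∂μ ≠ ∞ := by
    refine ((lintegral_mono hle₁).trans_lt ?_).ne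
    rw [lintegral_const_mul' _ _ ENNReal.ofReal_ne_top]
    exact ENNReal.mul_lt_top ENNReal.ofReal_lt_top hint.lt_top
  have hφm : Measurable fun x => ENNReal.ofReal (φ x) := hφ.ennreal_ofReal
  have hi₂ : ∫⁻ x, g₂ x ∂(μ.withDensity fun x => ENNReal.ofReal (φ x)) ≠ ∞ := by
    rw [lintegral_withDensity_eq_lintegral_mul _ hφm hm₂]
    refine ((lintegral_mono (g := fun x => ENNReal.ofReal α * ‖φ x - 1‖ₑ) fun x =>
      mul_le_mul' (ENNReal.ofReal_le_ofReal (hup x)) (hle₂ x)).trans_lt ?_).ne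
    rw [lintegral_const_mul' _ _ ENNReal.ofReal_ne_top]
    exact ENNReal.mul_lt_top ENNReal.ofReal_lt_top hint.lt_top
  set c₁ := expNeg (∫⁻ x, (1 - expNeg (g₁ x)) ∂μ) with hc₁
  set c₂ := expNeg (∫⁻ x, (1 - expNeg (g₂ x)) ∂(μ.withDensity fun x => ENNReal.ofReal (φ x)))
    with hc₂
  have hc₁0 : c₁ ≠ 0 := fun h => (ne_top_of_le_ne_top hi₁
    (lintegral_mono fun x => one_sub_expNeg_le _)) (expNeg_eq_zero_iff.1 h)
  have hc₂0 : c₂ ≠ 0 := fun h => (ne_top_of_le_ne_top hi₂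
    (lintegral_mono fun x => one_sub_expNeg_le _)) (expNeg_eq_zero_iff.1 h)
  have hc₁t : c₁ ≠ ∞ := expNeg_ne_top _
  have hc₂t : c₂ ≠ ∞ := expNeg_ne_top _
  have hG₁ : Measurable fun ω : Config X => expNeg (∫⁻ y, g₁ y ∂ω.1) :=
    measurable_expNeg.comp (measurable_config_lintegral hm₁)
  have hG₂ : Measurable fun ω : Config X => expNeg (∫⁻ y, g₂ y ∂ω.1) :=
    measurable_expNeg.comp (measurable_config_lintegral hm₂)
  have hlap₁ := fun (f : X → ℝ≥0∞) (hf : Measurable f) =>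
    hP.lintegral_withDensity_expNeg hf hm₁ hc₁0
  have hlap₂ := fun (f : X → ℝ≥0∞) (hf : Measurable f) =>
    hQ.lintegral_withDensity_expNeg hf hm₂ hc₂0
  have hfin : ∀ (R : Measure (Config X)) [IsProbabilityMeasure R] (c : ℝ≥0∞) (g : X → ℝ≥0∞),
      c ≠ 0 → IsFiniteMeasure (R.withDensity fun ω => c⁻¹ * expNeg (∫⁻ y, g y ∂ω.1)) :=
    fun R _ c g hc => isFiniteMeasure_withDensity (((lintegral_mono (g := fun _ => c⁻¹) fun ω =>
      mul_le_of_le_one_right' (expNeg_le_one _)).trans_lt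
        (by simpa using pos_iff_ne_zero.2 hc)).ne)
  have := hfin P c₁ g₁ hc₁0
  have := hfin Q c₂ g₂ hc₂0
  -- Both tilted laws have the Laplace functional of intensity `min φ 1 · μ`: `P` is tilted down
  -- where `φ < 1`, `Q` where `φ > 1`.
  have heq : (P.withDensity fun ω => c₁⁻¹ * expNeg (∫⁻ y, g₁ y ∂ω.1)) =
      Q.withDensity fun ω => c₂⁻¹ * expNeg (∫⁻ y, g₂ y ∂ω.1) :=
    ext_of_lintegral_expNeg fun f hf => by
      have hf' : Measurable fun x => expNeg (g₂ x) * (1 - expNeg (f x)) :=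
        (measurable_expNeg.comp hm₂).mul (measurable_const.sub (measurable_expNeg.comp hf))
      rw [hlap₁ f hf, hlap₂ f hf, lintegral_withDensity_eq_lintegral_mul _ hφm hf']
      simp only [Pi.mul_apply, ← mul_assoc, hE₁, hE₂]
  have hD : Measurable fun ω : Config X => c₂ * (expNeg (∫⁻ y, g₂ y ∂ω.1))⁻¹ :=
    hG₂.inv.const_mul _
  refine ⟨c₁⁻¹ * c₂, g₁, g₂, mul_ne_zero (ENNReal.inv_ne_zero.2 hc₁t) hc₂0, hm₁, hm₂, fun x => ?_, fun x => ?_,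
    hP.ae_lintegral_ne_top hm₁ hi₁, ?_⟩
  · refine ENNReal.ofReal_le_ofReal ?_
    rw [neg_le, ← Real.log_inv]
    exact Real.log_le_log (inv_pos.2 hα0) (hlow x)
  · exact ENNReal.ofReal_le_ofReal (Real.log_le_log (hpos x) (hup x))
  -- The tilt of `Q` can be undone because `∫ g₂ dω` is finite for `Q`-almost every `ω`, so the
  -- tilting factor does not vanish.
  · have h1 : Q = (Q.withDensity fun ω => c₂⁻¹ * expNeg (∫⁻ y, g₂ y ∂ω.1)).withDensity
        fun ω => c₂ * (expNeg (∫⁻ y, g₂ y ∂ω.1))⁻¹ := by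
      rw [← withDensity_mul _ (hG₂.const_mul _) hD]
      nth_rewrite 1 [← withDensity_one (μ := Q)]
      refine withDensity_congr_ae ?_
      filter_upwards [hQ.ae_lintegral_ne_top hm₂ hi₂] with ω hω
      have h0 : expNeg (∫⁻ y, g₂ y ∂ω.1) ≠ 0 := fun h => hω (expNeg_eq_zero_iff.1 h)
      simp only [Pi.mul_apply, Pi.one_apply]
      rw [mul_mul_mul_comm, ENNReal.inv_mul_cancel hc₂0 hc₂t,
        ENNReal.mul_inv_cancel h0 (expNeg_ne_top _), one_mul]
    rw [h1, ← heq, ← withDensity_mul _ (hG₁.const_mul _) hD]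
    congr 1
    funext ω
    simp only [Pi.mul_apply]
    rw [mul_mul_mul_comm]

end HasLaplace

/-! ### The zero-one law for divergence -/

/-- The family of configurations in which the first `N` members are replaced by the empty one. -/
noncomputable def dropFirst {X : Type*} [MeasurableSpace X] (N : ℕ) (ω : ℕ → Config X) :
    ℕ → Config X :=
  fun i => if i < N then pointConfig 0 Fin.elim0 else ω i

theorem lintegral_superpose_eq_add_dropFirst {X : Type*} [MeasurableSpace X] (f : X → ℝ≥0∞)
    (N : ℕ) (ω : ℕ → Config X) :
    ∫⁻ y, f y ∂(superpose ω).1 =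
      ∑ i ∈ Finset.range N, ∫⁻ y, f y ∂(ω i).1 + ∫⁻ y, f y ∂(superpose (dropFirst N ω)).1 := by
  rw [lintegral_superpose, lintegral_superpose,
    ← Summable.sum_add_tsum_nat_add' (f := fun i => ∫⁻ y, f y ∂(ω i).1) (k := N)
      ENNReal.summable,
    ← Summable.sum_add_tsum_nat_add' (f := fun i => ∫⁻ y, f y ∂(dropFirst N ω i).1) (k := N)
      ENNReal.summable]
  congr 1
  have h0 : ∑ i ∈ Finset.range N, ∫⁻ y, f y ∂(dropFirst N ω i).1 = 0 := by
    refine Finset.sum_eq_zero fun i hi => ?_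
    simp [dropFirst, Finset.mem_range.1 hi, pointConfig]
  rw [h0, zero_add]
  refine tsum_congr fun i => ?_
  simp [dropFirst]

theorem measurable_dropFirst_of_le {X : Type*} [MeasurableSpace X] {n N : ℕ} (h : n ≤ N) :
    Measurable[⨆ i ≥ n, MeasurableSpace.comap (fun ω : ℕ → Config X => ω i) inferInstance]
      (dropFirst (X := X) N) := by
  refine @measurable_pi_lambda _ _ _ (_) _ _ fun i => ?_
  by_cases hi : i < N
  · simp only [dropFirst, hi, if_true]
    exact measurable_const
  · simp only [dropFirst, hi, if_false]
    refine Measurable.mono (comap_measurable fun ω : ℕ → Config X => ω i) ?_ le_rfl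
    exact le_iSup₂_of_le i (h.trans (not_lt.1 hi)) le_rfl

/-- The superposition may have infinitely many points, but each piece has finitely many. Removing
finitely many pieces therefore costs only a finite factor. -/
theorem ae_finite_infinitePi_finitePoisson {X : Type*} [MeasurableSpace X] (ν : ℕ → Measure X)
    [∀ i, IsFiniteMeasure (ν i)] :
    ∀ᵐ ω ∂(Measure.infinitePi fun i => finitePoisson (ν i)), ∀ i, (ω i).1 univ ≠ ∞ := by
  refine ae_all_iff.2 fun i => ?_
  have h1 : ∀ᵐ ω ∂finitePoisson (ν i), ω.1 univ ≠ ∞ := by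
    have := (hasLaplace_finitePoisson (ν i)).ae_lintegral_ne_top
      (measurable_const (a := (1 : ℝ≥0∞))) (by simp)
    simpa using this
  rw [← Measure.infinitePi_map_eval (fun i => finitePoisson (ν i)) i] at h1
  exact ae_of_ae_map (measurable_pi_apply i).aemeasurable h1

/-- Zero-one law: for densities of the form `ω ↦ k ∏_{x ∈ ω} φ x` with uniformly bounded `log φ`,
the divergence of their sum does not depend on the points of `ω` in a set of finite measure. -/
theorem ae_tsum_density_eq_top_or_ne_top {X : Type*} [MeasurableSpace X] (μ : Measure X)
    [SigmaFinite μ] {C : ℝ≥0∞} (hC : C ≠ ∞) (k : ℕ → ℝ≥0∞) {g₁ g₂ : ℕ → X → ℝ≥0∞}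
    (hm₁ : ∀ n, Measurable (g₁ n)) (hm₂ : ∀ n, Measurable (g₂ n))
    (hg₁ : ∀ n x, g₁ n x ≤ C) (hg₂ : ∀ n x, g₂ n x ≤ C) :
    (∀ᵐ ω ∂poissonLaw μ,
      ∑' n, k n * (expNeg (∫⁻ y, g₁ n y ∂ω.1) * (expNeg (∫⁻ y, g₂ n y ∂ω.1))⁻¹) = ∞) ∨
    ∀ᵐ ω ∂poissonLaw μ,
      ∑' n, k n * (expNeg (∫⁻ y, g₁ n y ∂ω.1) * (expNeg (∫⁻ y, g₂ n y ∂ω.1))⁻¹) ≠ ∞ := by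
  set ν : ℕ → Measure X := fun i => μ.restrict (disjointed (spanningSets μ) i) with hν
  set ρ : Measure (ℕ → Config X) := Measure.infinitePi fun i => finitePoisson (ν i) with hR
  set h : ℕ → Config X → ℝ≥0∞ := fun n ω =>
    k n * (expNeg (∫⁻ y, g₁ n y ∂ω.1) * (expNeg (∫⁻ y, g₂ n y ∂ω.1))⁻¹) with hh
  have hhm : ∀ n, Measurable (h n) := fun n =>
    ((measurable_expNeg.comp (measurable_config_lintegral (hm₁ n))).mul
      (measurable_expNeg.comp (measurable_config_lintegral (hm₂ n))).inv).const_mul _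
  have hHm : Measurable fun ω => ∑' n, h n ω := Measurable.tsum hhm
  let D : Set (Config X) := {ω | ∑' n, h n ω = ∞}
  have hD : MeasurableSet D := hHm (measurableSet_singleton ∞)
  let F : ℕ → Set (ℕ → Config X) := fun N => (fun ω => superpose (dropFirst N ω)) ⁻¹' D
  have hF : ∀ {n N : ℕ}, n ≤ N → MeasurableSet[⨆ i ≥ n,
      MeasurableSpace.comap (fun ω : ℕ → Config X => ω i) inferInstance] (F N) := fun hnN =>
    (measurable_superpose.comp (measurable_dropFirst_of_le hnN)) hD
  -- `F N` and `D` agree where the configurations are finite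
  have hFD : ∀ ω : ℕ → Config X, (∀ i, (ω i).1 univ ≠ ∞) →
      ∀ N, (ω ∈ F N ↔ ∑' n, h n (superpose ω) = ∞) := by
    intro ω hω N
    -- An upper bound, the same for all `n`, for the integrals of `g₁ n` and `g₂ n` over the dropped
    -- points. Every term of the series thus changes by a factor between `e^{-m}` and `e^m`.
    set m : ℝ≥0∞ := C * ∑ i ∈ Finset.range N, (ω i).1 univ with hmdef
    have hm : m ≠ ∞ := ENNReal.mul_ne_top hC (ENNReal.sum_ne_top.2 fun i _ => hω i)
    have hE0 : expNeg m ≠ 0 := fun h => hm (expNeg_eq_zero_iff.1 h)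
    have hs : ∀ g : X → ℝ≥0∞, (∀ x, g x ≤ C) →
        expNeg m ≤ expNeg (∑ i ∈ Finset.range N, ∫⁻ y, g y ∂(ω i).1) := fun g hg => by
      refine expNeg_antitone ?_
      rw [hmdef, Finset.mul_sum]
      refine Finset.sum_le_sum fun i _ => ?_
      rw [← lintegral_const]
      exact lintegral_mono hg
    have hsplit : ∀ n, h n (superpose ω) =
        expNeg (∑ i ∈ Finset.range N, ∫⁻ y, g₁ n y ∂(ω i).1) *
          (expNeg (∑ i ∈ Finset.range N, ∫⁻ y, g₂ n y ∂(ω i).1))⁻¹ *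
            h n (superpose (dropFirst N ω)) := fun n => by
      simp only [hh]
      rw [lintegral_superpose_eq_add_dropFirst (g₁ n) N, expNeg_add,
        lintegral_superpose_eq_add_dropFirst (g₂ n) N, expNeg_add,
        ENNReal.mul_inv (Or.inr (expNeg_ne_top _)) (Or.inl (expNeg_ne_top _))]
      ring
    have hup : ∀ n, h n (superpose ω) ≤ (expNeg m)⁻¹ * h n (superpose (dropFirst N ω)) := by
      intro n
      rw [hsplit]
      refine mul_le_mul' ((mul_le_of_le_one_left' (expNeg_le_one _)).trans ?_) le_rfl
      exact ENNReal.inv_le_inv.2 (hs _ (hg₂ n))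
    have hlow : ∀ n, expNeg m * h n (superpose (dropFirst N ω)) ≤ h n (superpose ω) := by
      intro n
      rw [hsplit]
      refine mul_le_mul' ((hs _ (hg₁ n)).trans (le_mul_of_one_le_right' ?_)) le_rfl
      exact ENNReal.one_le_inv.2 (expNeg_le_one _)
    change (∑' n, h n (superpose (dropFirst N ω)) = ∞) ↔ _
    constructor
    · intro htop
      have := ENNReal.tsum_le_tsum hlow
      rw [ENNReal.tsum_mul_left, htop, ENNReal.mul_top hE0] at this
      exact top_le_iff.1 this
    · intro htop
      have := ENNReal.tsum_le_tsum hup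
      rw [ENNReal.tsum_mul_left, htop, top_le_iff, ENNReal.mul_eq_top] at this
      rcases this with h1 | h1
      · exact h1.2
      · exact absurd (ENNReal.inv_eq_top.1 h1.1) hE0
  have hindep : ProbabilityTheory.iIndep
      (fun i => MeasurableSpace.comap (fun ω : ℕ → Config X => ω i) inferInstance) ρ :=
    ProbabilityTheory.iIndepFun_infinitePi (X := fun _ (ω : Config X) => ω) fun _ => measurable_id
  -- Divergence agrees with each `F N` only almost everywhere. The limsup of the `F N` is a genuine
  -- tail event that represents it.
  have htail : MeasurableSet[limsup
      (fun i => MeasurableSpace.comap (fun ω : ℕ → Config X => ω i) inferInstance) atTop]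
      (limsup F atTop) := by
    rw [limsup_eq_iInf_iSup_of_nat, MeasurableSpace.measurableSet_iInf]
    intro n
    -- The shifted sequence has the same limsup and involves only pieces of index at least `n`.
    rw [← limsup_nat_add F n]
    exact @MeasurableSet.measurableSet_limsup _ (_) _ fun N => hF (Nat.le_add_left n N)
  have h01 := ProbabilityTheory.measure_zero_or_one_of_measurableSet_limsup_atTop
    (fun i => (measurable_pi_apply i).comap_le) hindep htail
  have hmem : ∀ᵐ ω ∂ρ, (ω ∈ limsup F atTop ↔ ∑' n, h n (superpose ω) = ∞) := by
    filter_upwards [ae_finite_infinitePi_finitePoisson ν] with ω hω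
    rw [mem_limsup_iff_frequently_mem]
    simp only [hFD ω hω, frequently_const]
  have hlim : MeasurableSet (limsup F atTop) :=
    MeasurableSet.measurableSet_limsup fun N =>
      (iSup₂_le fun i _ => (measurable_pi_apply i).comap_le) _ (hF (Nat.zero_le N))
  have hP : poissonLaw μ = ρ.map superpose := rfl
  rw [hP]
  rcases h01 with h0 | h1
  · right
    have hDc : MeasurableSet {ω | ∑' n, h n ω ≠ ∞} := hHm (measurableSet_singleton ∞).compl
    refine (ae_map_iff measurable_superpose.aemeasurable hDc).2 ?_
    filter_upwards [hmem, measure_eq_zero_iff_ae_notMem.1 h0] with ω hω hω'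
    exact fun h => hω' (hω.2 h)
  · left
    refine (ae_map_iff measurable_superpose.aemeasurable hD).2 ?_
    filter_upwards [hmem, (mem_ae_iff_prob_eq_one hlim).2 h1] with ω hω hω'
    exact hω.1 hω'

/-! ### Derivatives of the iterates of `T` -/

/-- A nonsingular transformation transports `μ` to a measure with a real density. -/
theorem IsNonsingular.map_eq_withDensity_jac {X : Type*} [MeasurableSpace X] {μ : Measure X}
    [SigmaFinite μ] {T : X ≃ᵐ X} (hT : IsNonsingular T μ) :
    μ.map T = μ.withDensity fun x => ENNReal.ofReal (jac T μ x) := by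
  have : SigmaFinite (μ.map T) := T.sigmaFinite_map
  nth_rewrite 1 [← Measure.withDensity_rnDeriv_eq _ _ hT.absolutelyContinuous_map]
  refine withDensity_congr_ae ?_
  filter_upwards [Measure.rnDeriv_lt_top (μ.map T) μ] with x hx
  rw [jac, ENNReal.ofReal_toReal hx.ne]

theorem map_withDensity_equiv {X : Type*} [MeasurableSpace X] (μ : Measure X) (T : X ≃ᵐ X)
    {f : X → ℝ≥0∞} (hf : Measurable f) :
    (μ.withDensity f).map T = (μ.map T).withDensity fun x => f (T.symm x) := by
  ext s hs
  have hfT : Measurable fun x => f (T.symm x) := hf.comp T.symm.measurable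
  rw [Measure.map_apply T.measurable hs, withDensity_apply _ (T.measurable hs),
    withDensity_apply _ hs, setLIntegral_map hs hfT T.measurable]
  simp

theorem measurable_jac {X : Type*} [MeasurableSpace X] (S : X → X) (μ : Measure X) :
    Measurable (jac S μ) :=
  (Measure.measurable_rnDeriv _ _).ennreal_toReal

/-- Membership in `Aut₁` passes to the iterates. -/
theorem MemAutOne.exists_density_iterate {X : Type*} [MeasurableSpace X] {μ : Measure X}
    [SigmaFinite μ] {T : X ≃ᵐ X} (hT : MemAutOne T μ) (n : ℕ) :
    ∃ φ : X → ℝ, Measurable φ ∧ (∀ x, 0 ≤ φ x) ∧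
      μ.map T^[n] = μ.withDensity (fun x => ENNReal.ofReal (φ x)) ∧
      ∫⁻ x, ‖φ x - 1‖ₑ ∂μ ≠ ∞ := by
  induction n with
  | zero => exact ⟨fun _ => 1, measurable_const, fun _ => zero_le_one, by simp, by simp⟩
  | succ n ih =>
    obtain ⟨φ, hφ, hφ0, hmap, hint⟩ := ih
    have hj : Measurable (jac T μ) := measurable_jac _ _
    have hj0 : ∀ x, 0 ≤ jac T μ x := fun x => ENNReal.toReal_nonneg
    have hφT : Measurable fun x => φ (T.symm x) := hφ.comp T.symm.measurable
    -- The chain rule `(Tⁿ⁺¹)' = T' · (Tⁿ)' ∘ T⁻¹`.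
    refine ⟨fun x => jac T μ x * φ (T.symm x), hj.mul hφT,
      fun x => mul_nonneg (hj0 x) (hφ0 _), ?_, ?_⟩
    · rw [Function.iterate_succ', ← Measure.map_map T.measurable (T.measurable.iterate n), hmap,
        map_withDensity_equiv _ _ hφ.ennreal_ofReal, hT.nonsingular.map_eq_withDensity_jac,
        ← withDensity_mul _ hj.ennreal_ofReal hφT.ennreal_ofReal]
      congr 1
      funext x
      rw [Pi.mul_apply, ENNReal.ofReal_mul (hj0 x)]
    -- Change of variables by `T`. It yields `‖(Tⁿ⁺¹)' - 1‖₁ ≤ ‖(Tⁿ)' - 1‖₁ + ‖T' - 1‖₁`.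
    · have h1 : ∫⁻ x, ENNReal.ofReal (jac T μ x) * ‖φ (T.symm x) - 1‖ₑ ∂μ =
          ∫⁻ x, ‖φ x - 1‖ₑ ∂μ := by
        have hm : Measurable fun x => ‖φ (T.symm x) - 1‖ₑ := (hφT.sub_const 1).enorm
        have := lintegral_withDensity_eq_lintegral_mul μ hj.ennreal_ofReal hm
        rw [← hT.nonsingular.map_eq_withDensity_jac, lintegral_map hm T.measurable] at this
        simpa using this.symm
      have h2 : ∫⁻ x, ‖jac T μ x - 1‖ₑ ∂μ < ∞ := hT.integrable.2
      refine ((lintegral_mono (g := fun x => ENNReal.ofReal (jac T μ x) * ‖φ (T.symm x) - 1‖ₑ +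
        ‖jac T μ x - 1‖ₑ) fun x => ?_).trans_lt ?_).ne
      · have : jac T μ x * φ (T.symm x) - 1 =
            jac T μ x * (φ (T.symm x) - 1) + (jac T μ x - 1) := by ring
        simp only [this]
        refine (enorm_add_le _ _).trans ?_
        rw [enorm_mul, Real.enorm_of_nonneg (hj0 x)]
      · rw [lintegral_add_right _ (hj.sub_const 1).enorm, h1]
        exact ENNReal.add_lt_top.2 ⟨hint.lt_top, h2⟩

/-- For `s ≥ 0`, `(√s - 1)² ≤ |√s - 1| (√s + 1) = |s - 1|`. -/
theorem MemAutOne.memAutTwo {X : Type*} [MeasurableSpace X] {μ : Measure X} {T : X ≃ᵐ X}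
    (hT : MemAutOne T μ) : MemAutTwo T μ := by
  refine ⟨hT.nonsingular, ?_⟩
  have hm : AEStronglyMeasurable (fun y => Real.sqrt (jac T μ y) - 1) μ :=
    ((measurable_jac T μ).sqrt.sub_const 1).aestronglyMeasurable
  rw [memLp_two_iff_integrable_sq hm]
  refine hT.integrable.mono (hm.pow 2) (ae_of_all _ fun y => ?_)
  have h0 : 0 ≤ jac T μ y := ENNReal.toReal_nonneg
  have hs := Real.sq_sqrt h0
  have hs0 := Real.sqrt_nonneg (jac T μ y)
  have hfac : jac T μ y - 1 = (Real.sqrt (jac T μ y) - 1) * (Real.sqrt (jac T μ y) + 1) := by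
    nlinarith
  rw [Real.norm_eq_abs, Real.norm_eq_abs, hfac, sq, abs_mul, abs_mul]
  refine mul_le_mul_of_nonneg_left ?_ (abs_nonneg _)
  rw [abs_of_nonneg (by linarith : 0 ≤ Real.sqrt (jac T μ y) + 1)]
  exact abs_le.2 ⟨by linarith, by linarith⟩

/-- Truncating the density at `α⁻¹` and `α` alters it only on a null set. The bounds then hold
everywhere, as needed for integrals against individual configurations. -/
theorem MemAutOne.exists_bounded_density_iterate {X : Type*} [MeasurableSpace X] {μ : Measure X}
    [SigmaFinite μ] {T : X ≃ᵐ X} (hT : MemAutOne T μ) {α : ℝ} (hα : 1 < α) {n : ℕ}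
    (hbound : ∀ᵐ x ∂μ, α⁻¹ < jac T^[n] μ x ∧ jac T^[n] μ x < α) :
    ∃ φ : X → ℝ, Measurable φ ∧ (∀ x, α⁻¹ ≤ φ x) ∧ (∀ x, φ x ≤ α) ∧
      μ.map T^[n] = μ.withDensity (fun x => ENNReal.ofReal (φ x)) ∧
      ∫⁻ x, ‖φ x - 1‖ₑ ∂μ ≠ ∞ := by
  obtain ⟨φ, hφ, hφ0, hmap, hint⟩ := hT.exists_density_iterate n
  have hinv : α⁻¹ ≤ α := (inv_le_one_of_one_le₀ hα.le).trans hα.le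
  have hae : φ =ᵐ[μ] fun x => max α⁻¹ (min α (φ x)) := by
    have h1 := Measure.rnDeriv_withDensity μ hφ.ennreal_ofReal
    rw [← hmap] at h1
    filter_upwards [h1, hbound] with x hx hb
    rw [jac, hx, ENNReal.toReal_ofReal (hφ0 x)] at hb
    rw [min_eq_right hb.2.le, max_eq_right hb.1.le]
  refine ⟨fun x => max α⁻¹ (min α (φ x)), by fun_prop, fun x => le_max_left _ _,
    fun x => max_le hinv (min_le_left _ _), ?_, ?_⟩
  · rw [hmap]
    refine withDensity_congr_ae ?_
    filter_upwards [hae] with x hx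
    rw [← hx]
  · rw [← lintegral_congr_ae (f := fun x => ‖φ x - 1‖ₑ)]
    · exact hint
    · filter_upwards [hae] with x hx
      rw [← hx]

/-! ### The dichotomy and intensity scaling -/

/-- The dichotomy for the Poisson suspension of a transformation whose iterates have uniformly
bounded densities that differ from `1` by an integrable function. -/
theorem conservative_or_totallyDissipative_suspension {X : Type*} [MeasurableSpace X]
    (μ : Measure X) [SigmaFinite μ] (T : X ≃ᵐ X) {α : ℝ} (hα : 1 < α)
    (hT : ∀ n : ℕ, ∃ φ : X → ℝ, Measurable φ ∧ (∀ x, α⁻¹ ≤ φ x) ∧ (∀ x, φ x ≤ α) ∧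
      μ.map T^[n + 1] = μ.withDensity (fun x => ENNReal.ofReal (φ x)) ∧
      ∫⁻ x, ‖φ x - 1‖ₑ ∂μ ≠ ∞) :
    Conservative (suspension T) (poissonLaw μ) ∨
      IsTotallyDissipative (suspension T) (poissonLaw μ) := by
  have hP := hasLaplace_poissonLaw μ
  have hdens : ∀ n : ℕ, ∃ (k : ℝ≥0∞) (g₁ g₂ : X → ℝ≥0∞), k ≠ 0 ∧
      Measurable g₁ ∧ Measurable g₂ ∧
      (∀ x, g₁ x ≤ ENNReal.ofReal (Real.log α)) ∧ (∀ x, g₂ x ≤ ENNReal.ofReal (Real.log α)) ∧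
      (∀ᵐ ω ∂poissonLaw μ, ∫⁻ y, g₁ y ∂ω.1 ≠ ∞) ∧
      (poissonLaw μ).map (suspension T)^[n + 1] = (poissonLaw μ).withDensity fun ω =>
        k * (expNeg (∫⁻ y, g₁ y ∂ω.1) * (expNeg (∫⁻ y, g₂ y ∂ω.1))⁻¹) := by
    intro n
    obtain ⟨φ, hφ, hlow, hup, hmap, hint⟩ := hT n
    have hQ := hP.map_suspension_iterate T (n + 1)
    rw [hmap] at hQ
    have : IsProbabilityMeasure ((poissonLaw μ).map (suspension T)^[n + 1]) :=
      Measure.isProbabilityMeasure_map ((suspension T).measurable.iterate _).aemeasurable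
    exact hP.exists_density hφ hα hlow hup hQ hint
  choose k g₁ g₂ hk0 hm₁ hm₂ hg₁ hg₂ hfin hd using hdens
  have hhm : ∀ n, Measurable fun ω : Config X =>
      k n * (expNeg (∫⁻ y, g₁ n y ∂ω.1) * (expNeg (∫⁻ y, g₂ n y ∂ω.1))⁻¹) := fun n =>
    ((measurable_expNeg.comp (measurable_config_lintegral (hm₁ n))).mul
      (measurable_expNeg.comp (measurable_config_lintegral (hm₂ n))).inv).const_mul _
  -- The density of the first image is almost everywhere nonzero, so the two laws are equivalent.
  have hns : IsNonsingular (suspension T) (poissonLaw μ) := by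
    have h0 := hd 0
    rw [zero_add, Function.iterate_one] at h0
    refine ⟨h0 ▸ withDensity_absolutelyContinuous _ _,
      h0 ▸ withDensity_absolutelyContinuous' (hhm 0).aemeasurable ?_⟩
    filter_upwards [hfin 0] with ω hω
    exact mul_ne_zero (hk0 0) (mul_ne_zero (fun h => hω (expNeg_eq_zero_iff.1 h))
      (ENNReal.inv_ne_zero.2 (expNeg_ne_top _)))
  exact conservative_or_totallyDissipative _ _ hns hhm hd
    (ae_tsum_density_eq_top_or_ne_top μ ENNReal.ofReal_ne_top k hm₁ hm₂ hg₁ hg₂)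

end PoissonSuspension

open PoissonSuspension
theorem theorem7p2 {X : Type*} [MeasurableSpace X] [StandardBorelSpace X]
    (μ : Measure X) [SigmaFinite μ] [NullSingletonClass μ] (hμ : μ univ = ∞)
    (T : X ≃ᵐ X) (hT : MemAutOne T μ) (α : ℝ) (hα : 1 < α)
    (hbound : ∀ n : ℕ, 0 < n → ∀ᵐ x ∂μ, α⁻¹ < jac T^[n] μ x ∧ jac T^[n] μ x < α) :
    (Conservative (suspension T) (poissonLaw μ) ∨
      IsTotallyDissipative (suspension T) (poissonLaw μ)) ∧
    IsCCIS T μ := by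
  have hdens := fun n : ℕ => hT.exists_bounded_density_iterate hα (hbound (n + 1) n.succ_pos)
  refine ⟨conservative_or_totallyDissipative_suspension μ T hα hdens, hT.memAutTwo, fun t ht => ?_⟩
  -- The same `φ` is a density for `t μ`, and the integral of `|φ - 1|` is only multiplied by `t`.
  refine conservative_or_totallyDissipative_suspension (t • μ) T hα fun n => ?_
  obtain ⟨φ, hφ, hlow, hup, hmap, hint⟩ := hdens n
  refine ⟨φ, hφ, hlow, hup, ?_, ?_⟩
  · rw [Measure.map_smul, hmap]
    exact (withDensity_smul_measure _ _).symm
  · rw [lintegral_smul_measure]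
    exact ENNReal.mul_ne_top ENNReal.coe_ne_top hint
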